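/- Let $G$ be a finite group and let $\mathsf{Sub}(G)$ be its lattice of subgroups, on which $G$ acts by conjugation. A transfer system on $\mathsf{Sub}(G)$ is a partial order $\to$ on $\mathsf{Sub}(G)$ such that $H\to K$ implies $H\le K$; $H\to K$ implies $gHg^{-1}\to gKg^{-1}$ for all $g\in G$; and $H\to K$ and $K'\le K$ imply $H\cap K'\to K'$. Ordered by inclusion of relations, the transfer systems form a finite lattice $\mathsf{Tr}(\mathsf{Sub}(G))$. For a finite lattice $L$ let $J(L)$ and $M(L)$ be its sets of join-irreducible and of meet-irreducible elements (an element $x$ is join-irreducible if it is not the minimum and $x=a\vee b$ implies $x=a$ or $x=b$; meet-irreducibility is dual), and define the codensity of $L$ as \[\rho(L)=\frac{|\{(A,B)\in J(L)\times M(L) : A\not\le B\}|}{|J(L)|\,|M(L)|}.\] Let $C_p$ denote the cyclic group of order $p$. **Corollary 6.2** (limits of codensity for $C_p^n$). For every integer $n\ge 2$, with $p$ ranging over the prime numbers, \[\lim_{p\to\infty}\rho(\mathsf{Tr}(\mathsf{Sub}(C_p^n)))=\begin{cases}1/4 & \text{if } n=2,\\ 0 & \text{if } n>2.\end{cases}\]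 Moreover, for every prime $p$, \[\lim_{n\to\infty}\rho(\mathsf{Tr}(\mathsf{Sub}(C_p^n)))=0.\] -/

import Mathlib

open Filter Topology

namespace HomotopicalCombinatorics

/-- The action of `G` on the lattice `L` is by lattice automorphisms. It suffices to ask that each
`g` acts monotonically, since then `g` and `g⁻¹` act as mutually inverse order isomorphisms. -/
class IsGLattice (G L : Type*) [Group G] [Lattice L] [MulAction G L] : Prop where
  smul_le_smul : ∀ (g : G) {x y : L}, x ≤ y → g • x ≤ g • y

/-- A transfer system on a `G`-lattice `L`: a partial order `rel` on `L` which refines `≤`, is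
`G`-equivariant, and is closed under restriction. Antisymmetry of `rel` is automatic from
`rel x y → x ≤ y`, see `TransferSystem.antisymm`. -/
@[ext]
structure TransferSystem (G L : Type*) [Group G] [Lattice L] [MulAction G L] where
  /-- the relation `x → y` -/
  rel : L → L → Prop
  refl : ∀ x, rel x x
  trans : ∀ {x y z}, rel x y → rel y z → rel x z
  le_of_rel : ∀ {x y}, rel x y → x ≤ y
  smul_rel : ∀ (g : G) {x y}, rel x y → rel (g • x) (g • y)
  restrict : ∀ {x y x'}, rel x y → x' ≤ y → rel (x ⊓ x') x'

namespace TransferSystem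

variable {G L : Type*} [Group G] [Lattice L] [MulAction G L]

theorem antisymm (T : TransferSystem G L) {x y : L} (h : T.rel x y) (h' : T.rel y x) : x = y :=
  le_antisymm (T.le_of_rel h) (T.le_of_rel h')

/-- Transfer systems are ordered by refinement, i.e. inclusion of relations. -/
instance instPartialOrder : PartialOrder (TransferSystem G L) where
  le S T := ∀ x y, S.rel x y → T.rel x y
  le_refl _ _ _ h := h
  le_trans _ _ _ h₁ h₂ x y h := h₂ x y (h₁ x y h)
  le_antisymm S T h₁ h₂ := by
    ext x y
    exact ⟨h₁ x y, h₂ x y⟩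

theorem le_def {S T : TransferSystem G L} : S ≤ T ↔ ∀ x y, S.rel x y → T.rel x y := Iff.rfl

/-- The intersection of a set of transfer systems (for the empty set: the relation `≤`). -/
instance instInfSet [IsGLattice G L] : InfSet (TransferSystem G L) where
  sInf 𝒯 :=
    { rel := fun x y => x ≤ y ∧ ∀ T ∈ 𝒯, T.rel x y
      refl := fun x => ⟨le_rfl, fun T _ => T.refl x⟩
      trans := fun h₁ h₂ => ⟨h₁.1.trans h₂.1, fun T hT => T.trans (h₁.2 T hT) (h₂.2 T hT)⟩
      le_of_rel := fun h => h.1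
      smul_rel := fun g _ _ h =>
        ⟨IsGLattice.smul_le_smul g h.1, fun T hT => T.smul_rel g (h.2 T hT)⟩
      restrict := fun h hx => ⟨inf_le_right, fun T hT => T.restrict (h.2 T hT) hx⟩ }

theorem isGLB_sInf [IsGLattice G L] (𝒯 : Set (TransferSystem G L)) : IsGLB 𝒯 (sInf 𝒯) :=
  ⟨fun T hT _ _ h => h.2 T hT,
    fun S hS x y h => ⟨S.le_of_rel h, fun _ hT => hS hT x y h⟩⟩

/-- The complete lattice of transfer systems, with intersections as meets. -/
instance instCompleteLattice [IsGLattice G L] : CompleteLattice (TransferSystem G L) :=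
  completeLatticeOfInf _ isGLB_sInf

instance instFinite [Finite L] : Finite (TransferSystem G L) :=
  Finite.of_injective (fun T : TransferSystem G L => T.rel) fun _ _ h => TransferSystem.ext h

end TransferSystem

section Sub

open scoped Pointwise

/-- `G` acts on its subgroup lattice by conjugation (`ConjAct G` is `G` acting on itself by
conjugation; the action on subgroups is the pointwise one), and this is by lattice
automorphisms. -/
instance instIsGLatticeSubgroup (G : Type*) [Group G] : IsGLattice (ConjAct G) (Subgroup G) where
  smul_le_smul _ _ _ h := Subgroup.pointwise_smul_le_pointwise_smul_iff.2 h

/-- `Tr(Sub(G))`: transfer systems on the subgroup lattice of `G` with the conjugation action. -/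
abbrev TrSub (G : Type*) [Group G] : Type _ := TransferSystem (ConjAct G) (Subgroup G)

end Sub

/-- The codensity of the context `(J(L), M(L), ≤)` of a finite lattice `L`: the proportion of pairs
`(A, B)` of a join-irreducible `A` and a meet-irreducible `B` with `A ≰ B`. -/
noncomputable def codensity (L : Type*) [Lattice L] [Finite L] : ℝ :=
  ({q : L × L | SupIrred q.1 ∧ InfIrred q.2 ∧ ¬ q.1 ≤ q.2}.ncard : ℝ) /
    (({A : L | SupIrred A}.ncard : ℝ) * ({B : L | InfIrred B}.ncard : ℝ))

instance instFactPrime (p : Nat.Primes) : Fact (Nat.Prime (p : ℕ)) := ⟨p.2⟩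

/-- The elementary abelian group `C_p^n`, written multiplicatively. -/
abbrev ElemAb (p n : ℕ) : Type := Fin n → Multiplicative (ZMod p)

end HomotopicalCombinatorics

/-! Conjugation in an abelian group is trivial. For a trivial action the join-irreducible transfer
systems are exactly the `gen x y` and the meet-irreducible ones exactly the `lifting a b`, each
indexed by the strict pairs of the lattice (`supIrred_iff`, `infIrred_iff`). Hence the codensity is
Q / N², where N counts strict pairs and Q counts pairs `x < y`, `a < b` with a failed lift
(`codensity_transferSystem`).

Subgroups of `C_p^n` are subspaces of an n-dimensional space over a field with q = p elements. A
failed lift has `b ≤ y`. If `y` is proper, `(a, b)` lies in a hyperplane, which holds few of the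
strict pairs (`ncard_ltPairs_le_mul_pow_le`); if `y = ⊤`, only `x` and `(a, b)` remain free, and
there are far fewer subspaces than strict pairs (`card_submodule_mul_pow_le`). Together Q / N² ≤ 4 /
q^⌊(n-1)/2⌋, which yields every limit 0. For n = 2 this bound is too weak, but the lattice is `⊥`,
`⊤` and q + 1 lines, where N ~ 2q and Q ~ q². -/

namespace HomotopicalCombinatorics

/-! ### Irreducible transfer systems for a trivial action -/

namespace TransferSystem

variable {G L : Type*} [Group G] [Lattice L] [MulAction G L]

/-- The smallest transfer system containing `x → y`. -/
def gen [IsGLattice G L] (x y : L) : TransferSystem G L := sInf {T | T.rel x y}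

theorem gen_le_iff [IsGLattice G L] {x y : L} (hxy : x ≤ y) {T : TransferSystem G L} :
    gen x y ≤ T ↔ T.rel x y :=
  ⟨fun h => h x y ⟨hxy, fun _ hT => hT⟩, fun h => sInf_le h⟩

theorem gen_rel [IsGLattice G L] {x y : L} (hxy : x ≤ y) : (gen x y : TransferSystem G L).rel x y :=
  (gen_le_iff hxy).1 le_rfl

/-- The relations `z → w` with `w ≤ y`, where `z → y` is allowed for `z ∈ s` only. -/
def bounded (triv : ∀ (g : G) (x : L), g • x = x) (s : Set L) (y : L) : TransferSystem G L where
  rel z w := z ≤ w ∧ (z = w ∨ (w ≤ y ∧ (w = y → ∃ u ∈ s, z ≤ u)))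
  refl x := ⟨le_rfl, Or.inl rfl⟩
  trans := by
    rintro a b c ⟨h1, h1'⟩ ⟨h2, h2'⟩
    refine ⟨h1.trans h2, ?_⟩
    rcases h1' with rfl | h1'
    · exact h2'
    rcases h2' with rfl | h2'
    · exact Or.inr h1'
    refine Or.inr ⟨h2'.1, fun h => ?_⟩
    obtain ⟨u, hu, hb⟩ := h2'.2 h
    exact ⟨u, hu, h1.trans hb⟩
  le_of_rel h := h.1
  smul_rel g x y h := by simpa only [triv] using h
  restrict := by
    rintro a b c ⟨h1, h1'⟩ h2
    refine ⟨inf_le_right, ?_⟩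
    rcases h1' with rfl | ⟨h3, h4⟩
    · exact Or.inl (inf_eq_right.2 h2)
    refine Or.inr ⟨h2.trans h3, fun h => ?_⟩
    obtain ⟨u, hu, hb⟩ := h4 (le_antisymm h3 (h ▸ h2))
    exact ⟨u, hu, inf_le_left.trans hb⟩

theorem gen_rel_imp [IsGLattice G L] (triv : ∀ (g : G) (x : L), g • x = x) {x y z w : L}
    (hxy : x ≤ y) (h : (gen x y : TransferSystem G L).rel z w) :
    z = w ∨ (w ≤ y ∧ (w = y → z ≤ x)) := by
  have h0 : gen x y ≤ bounded triv {x} y :=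
    (gen_le_iff hxy).2 ⟨hxy, Or.inr ⟨le_rfl, fun _ => ⟨x, rfl, le_rfl⟩⟩⟩
  simpa using (h0 z w h).2

theorem gen_injective [IsGLattice G L] (triv : ∀ (g : G) (x : L), g • x = x) {x y x' y' : L}
    (h : x < y) (h' : x' < y') (he : (gen x y : TransferSystem G L) = gen x' y') :
    x = x' ∧ y = y' := by
  have h1 := gen_rel_imp triv h'.le (he ▸ gen_rel h.le)
  have h2 := gen_rel_imp triv h.le (he.symm ▸ gen_rel h'.le)
  have h1 := h1.resolve_left h.ne
  have h2 := h2.resolve_left h'.ne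
  have hy := le_antisymm h1.1 h2.1
  exact ⟨le_antisymm (h1.2 hy) (h2.2 hy.symm), hy⟩

/-- Everything strictly below `gen x y` lies in `bounded triv (Set.Iio x) y`, which omits `x → y`;
so two such systems cannot join to `gen x y`. -/
theorem supIrred_gen [IsGLattice G L] (triv : ∀ (g : G) (x : L), g • x = x) {x y : L}
    (h : x < y) : SupIrred (gen x y : TransferSystem G L) := by
  constructor
  · intro hm
    have h0 : (gen x y : TransferSystem G L) ≤ gen x x := by
      rw [isMin_iff_eq_bot.1 hm]; exact bot_le
    have := (gen_rel_imp triv le_rfl (h0 x y (gen_rel h.le))).resolve_left h.ne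
    exact absurd this.1 h.not_ge
  · intro B C hBC
    by_contra hne
    rw [not_or] at hne
    have key : ∀ B : TransferSystem G L, B ≤ gen x y → B ≠ gen x y →
        B ≤ bounded triv (Set.Iio x) y := by
      intro B hB hne z w hzw
      refine ⟨B.le_of_rel hzw, ?_⟩
      rcases gen_rel_imp triv h.le (hB z w hzw) with h1 | h1
      · exact Or.inl h1
      refine Or.inr ⟨h1.1, fun hw => ⟨z, lt_of_le_of_ne (h1.2 hw) ?_, le_rfl⟩⟩
      rintro rfl
      subst hw
      exact hne (le_antisymm hB ((gen_le_iff h.le).2 hzw))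
    have h2 : B ⊔ C ≤ bounded triv (Set.Iio x) y :=
      sup_le (key B (hBC ▸ le_sup_left) hne.1) (key C (hBC ▸ le_sup_right) hne.2)
    rw [hBC] at h2
    obtain ⟨u, hu, hxu⟩ := ((h2 x y (gen_rel h.le)).2.resolve_left h.ne).2 rfl
    exact absurd hu hxu.not_gt

theorem supIrred_iff [IsGLattice G L] [Finite L] (triv : ∀ (g : G) (x : L), g • x = x)
    (T : TransferSystem G L) : SupIrred T ↔ ∃ x y, x < y ∧ gen x y = T := by
  refine ⟨fun hT => ?_, fun ⟨x, y, h, he⟩ => he ▸ supIrred_gen triv h⟩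
  have hfin : {q : L × L | T.rel q.1 q.2}.Finite := Set.toFinite _
  obtain ⟨⟨x, y⟩, hq, he⟩ := hT.finset_sup_eq
    (s := hfin.toFinset) (f := fun q => gen q.1 q.2) <| by
      apply le_antisymm
      · refine Finset.sup_le fun q hq => ?_
        have hq : T.rel q.1 q.2 := by simpa using hq
        exact (gen_le_iff (T.le_of_rel hq)).2 hq
      · intro x y hxy
        have := Finset.le_sup (f := fun q : L × L => (gen q.1 q.2 : TransferSystem G L))
          (hfin.mem_toFinset.2 (show (x, y) ∈ {q : L × L | T.rel q.1 q.2} from hxy))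
        exact this x y (gen_rel (T.le_of_rel hxy))
  have hq : T.rel x y := by simpa using hq
  refine ⟨x, y, lt_of_le_of_ne (T.le_of_rel hq) ?_, he⟩
  rintro rfl
  refine hT.ne_bot (he ▸ le_bot_iff.1 ((gen_le_iff le_rfl).2 (refl _ _)))

/-- The relations with the right lifting property against `a → b`. -/
def lifting (triv : ∀ (g : G) (x : L), g • x = x) (a b : L) : TransferSystem G L where
  rel z w := z ≤ w ∧ (a ≤ z → b ≤ w → b ≤ z)
  refl x := ⟨le_rfl, fun _ h => h⟩
  trans h h' := ⟨h.1.trans h'.1, fun ha hb => h.2 ha (h'.2 (ha.trans h.1) hb)⟩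
  le_of_rel h := h.1
  smul_rel g x y h := by simpa only [triv] using h
  restrict h hx :=
    ⟨inf_le_right, fun ha hb => le_inf (h.2 (ha.trans inf_le_left) (hb.trans hx)) hb⟩

theorem not_lifting_rel (triv : ∀ (g : G) (x : L), g • x = x) {a b : L} (h : a < b) :
    ¬ (lifting triv a b).rel a b :=
  fun h' => h.not_ge (h'.2 le_rfl le_rfl)

theorem lifting_injective (triv : ∀ (g : G) (x : L), g • x = x) {a b a' b' : L}
    (h : a < b) (h' : a' < b') (he : lifting triv a b = lifting triv a' b') :
    a = a' ∧ b = b' := by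
  have h1 := not_lifting_rel triv h
  have h2 := not_lifting_rel triv h'
  rw [he] at h1
  rw [← he] at h2
  simp only [lifting, h.le, h'.le, true_and, Classical.not_imp] at h1 h2
  exact ⟨le_antisymm h2.1 h1.1, le_antisymm h2.2.1 h1.2.1⟩

/-- A relation `z → w` of `T` that fails to lift restricts to `z ⊓ b → b`, while `a → z ⊓ b` already
belongs to `lifting triv a b`; composing gives `a → b`. So every system strictly above `lifting triv
a b` contains `a → b`, which forces meet-irreducibility. -/
theorem rel_of_not_le_lifting (triv : ∀ (g : G) (x : L), g • x = x) {a b : L}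
    {T : TransferSystem G L} (h : lifting triv a b ≤ T) (h' : ¬ T ≤ lifting triv a b) :
    a ≤ b → T.rel a b := by
  intro hab
  simp only [le_def, not_forall] at h'
  obtain ⟨z, w, hzw, hn⟩ := h'
  simp only [lifting, T.le_of_rel hzw, true_and, Classical.not_imp] at hn
  obtain ⟨haz, hbw, hbz⟩ := hn
  refine T.trans (h a (z ⊓ b) ⟨le_inf haz hab, fun _ hb => ?_⟩) (T.restrict hzw hbw)
  exact absurd (hb.trans inf_le_left) hbz

theorem infIrred_lifting [IsGLattice G L] (triv : ∀ (g : G) (x : L), g • x = x) {a b : L}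
    (h : a < b) : InfIrred (lifting triv a b) := by
  constructor
  · intro hm
    have h0 : lifting triv a a ≤ lifting triv a b := by
      rw [isMax_iff_eq_top.1 hm]; exact le_top
    exact not_lifting_rel triv h (h0 a b ⟨h.le, fun _ _ => le_rfl⟩)
  · intro B C hBC
    by_contra hne
    rw [not_or] at hne
    have key : ∀ B : TransferSystem G L, lifting triv a b ≤ B → B ≠ lifting triv a b →
        B.rel a b := fun B hB hne =>
      rel_of_not_le_lifting triv hB (fun h' => hne (le_antisymm h' hB)) h.le
    have h1 := key B (hBC ▸ inf_le_left) hne.1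
    have h2 := key C (hBC ▸ inf_le_right) hne.2
    refine not_lifting_rel triv h ((?_ : gen a b ≤ lifting triv a b) a b (gen_rel h.le))
    rw [← hBC]
    exact le_inf ((gen_le_iff h.le).2 h1) ((gen_le_iff h.le).2 h2)

/-- Separates `T` from a missing relation, so that `T` is the meet of the lifting systems above it.
-/
theorem exists_le_lifting [Finite L] (triv : ∀ (g : G) (x : L), g • x = x)
    (T : TransferSystem G L) {z w : L} (hzw : z ≤ w) (h : ¬ T.rel z w) :
    ∃ a b, a < b ∧ T ≤ lifting triv a b ∧ ¬ (lifting triv a b).rel z w := by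
  -- The separating pair is `z < u`, with `u` minimal among the elements above `z` that transfer to
  -- `w`: a relation `s → t` of `T` with `z ≤ s`, `u ≤ t` gives `s ⊓ u → u → w`, so minimality
  -- yields `u ≤ s`.
  obtain ⟨u, ⟨hzu, huw⟩, hmin⟩ := Set.Finite.exists_minimal
    (Set.toFinite {u | z ≤ u ∧ T.rel u w}) ⟨w, hzw, T.refl w⟩
  refine ⟨z, u, lt_of_le_of_ne hzu ?_, fun s t hst => ⟨T.le_of_rel hst, fun hzs hut => ?_⟩, ?_⟩
  · rintro rfl
    exact h huw
  · have := T.trans (T.restrict hst hut) huw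
    exact (hmin ⟨le_inf hzs hzu, this⟩ inf_le_right).trans inf_le_left
  · intro hl
    have hu := hl.2 le_rfl (T.le_of_rel huw)
    exact h (le_antisymm hzu hu ▸ huw)

theorem infIrred_iff [IsGLattice G L] [Finite L] (triv : ∀ (g : G) (x : L), g • x = x)
    (T : TransferSystem G L) : InfIrred T ↔ ∃ a b, a < b ∧ lifting triv a b = T := by
  refine ⟨fun hT => ?_, fun ⟨x, y, h, he⟩ => he ▸ infIrred_lifting triv h⟩
  have hfin : {q : L × L | q.1 < q.2 ∧ T ≤ lifting triv q.1 q.2}.Finite := Set.toFinite _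
  obtain ⟨⟨a, b⟩, hq, he⟩ := hT.finset_inf_eq
    (s := hfin.toFinset) (f := fun q => lifting triv q.1 q.2) <| by
      apply le_antisymm
      · intro z w hzw
        by_contra hn
        obtain ⟨a, b, hab, hT, hn'⟩ := exists_le_lifting triv T (le_of_rel _ hzw) hn
        exact hn' (Finset.inf_le (f := fun q : L × L => lifting triv q.1 q.2)
          (hfin.mem_toFinset.2 (⟨hab, hT⟩ :
            (a, b) ∈ {q : L × L | q.1 < q.2 ∧ T ≤ lifting triv q.1 q.2})) z w hzw)
      · exact Finset.le_inf fun q hq => ((hfin.mem_toFinset.1 hq : _ ∧ _)).2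
  exact ⟨a, b, ((hfin.mem_toFinset.1 hq : _ ∧ _)).1, he⟩

end TransferSystem

/-! ### Codensity as a count of failed lifts -/

/-- The pairs `x < y` in a lattice. -/
def ltPairs (L : Type*) [Lattice L] : Set (L × L) := {q | q.1 < q.2}

/-- The pairs of `x ≤ y` and `a ≤ b` such that `x → y` fails to lift against `a → b`. -/
def nonLifting (L : Type*) [Lattice L] : Set ((L × L) × (L × L)) :=
  {q | q.1 ∈ ltPairs L ∧ q.2 ∈ ltPairs L ∧ q.2.1 ≤ q.1.1 ∧ q.2.2 ≤ q.1.2 ∧ ¬ q.2.2 ≤ q.1.1}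

open TransferSystem in
theorem codensity_transferSystem {G L : Type*} [Group G] [Lattice L] [MulAction G L]
    [IsGLattice G L] [Finite L] (triv : ∀ (g : G) (x : L), g • x = x) :
    codensity (TransferSystem G L) = ((nonLifting L).ncard : ℝ) / ((ltPairs L).ncard : ℝ) ^ 2 := by
  have h1 : {A : TransferSystem G L | SupIrred A} = (fun q => gen q.1 q.2) '' ltPairs L := by
    ext T; simp [supIrred_iff triv, ltPairs]
  have h2 : {A : TransferSystem G L | InfIrred A} =
      (fun q => lifting triv q.1 q.2) '' ltPairs L := by
    ext T; simp [infIrred_iff triv, ltPairs]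
  have h3 : {q : TransferSystem G L × TransferSystem G L |
        SupIrred q.1 ∧ InfIrred q.2 ∧ ¬ q.1 ≤ q.2} =
      (fun q => (gen q.1.1 q.1.2, lifting triv q.2.1 q.2.2)) '' nonLifting L := by
    have key : ∀ {x y a b : L}, x < y → (¬ (gen x y : TransferSystem G L) ≤ lifting triv a b ↔
        a ≤ x ∧ b ≤ y ∧ ¬ b ≤ x) := by
      intro x y a b h
      rw [gen_le_iff h.le]
      simp [lifting, h.le]
    ext ⟨S, T⟩
    simp only [supIrred_iff triv, infIrred_iff triv, Set.mem_ofPred_eq, Set.mem_image, nonLifting,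
      ltPairs, Prod.exists, Prod.mk.injEq]
    constructor
    · rintro ⟨⟨x, y, hxy, rfl⟩, ⟨a, b, hab, rfl⟩, h⟩
      exact ⟨x, y, a, b, ⟨hxy, hab, (key hxy).1 h⟩, rfl, rfl⟩
    · rintro ⟨x, y, a, b, ⟨hxy, hab, h⟩, rfl, rfl⟩
      exact ⟨⟨x, y, hxy, rfl⟩, ⟨a, b, hab, rfl⟩, (key hxy).2 h⟩
  have i1 : Set.InjOn (fun q : L × L => (gen q.1 q.2 : TransferSystem G L)) (ltPairs L) :=
    fun q hq r hr h => Prod.ext_iff.2 (gen_injective triv hq hr h)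
  have i2 : Set.InjOn (fun q : L × L => lifting triv q.1 q.2) (ltPairs L) :=
    fun q hq r hr h => Prod.ext_iff.2 (lifting_injective triv hq hr h)
  have i3 : Set.InjOn (fun q : (L × L) × (L × L) =>
      ((gen q.1.1 q.1.2 : TransferSystem G L), lifting triv q.2.1 q.2.2)) (nonLifting L) :=
    fun q hq r hr h => Prod.ext_iff.2
      ⟨i1 hq.1 hr.1 (Prod.ext_iff.1 h).1, i2 hq.2.1 hr.2.1 (Prod.ext_iff.1 h).2⟩
  rw [codensity, h1, h2, h3, i1.ncard_image, i2.ncard_image,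
    i3.ncard_image, sq]

theorem ncard_ltPairs_congr {L M : Type*} [Lattice L] [Lattice M] (e : L ≃o M) :
    (ltPairs L).ncard = (ltPairs M).ncard :=
  Nat.card_congr ((e.toEquiv.prodCongr e.toEquiv).subtypeEquiv fun q => by simp [ltPairs])

theorem ncard_nonLifting_congr {L M : Type*} [Lattice L] [Lattice M] (e : L ≃o M) :
    (nonLifting L).ncard = (nonLifting M).ncard :=
  Nat.card_congr (((e.toEquiv.prodCongr e.toEquiv).prodCongr
    (e.toEquiv.prodCongr e.toEquiv)).subtypeEquiv fun q => by simp [nonLifting, ltPairs])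

/-! ### Counting pairs in finite lattices -/

section Lattice

theorem ncard_le_ncard_mul {α β : Type*} [Finite α] [Finite β] {S : Set (α × β)} {s : Set α}
    {m : ℕ} (hs : ∀ x ∈ S, x.1 ∈ s) (hm : ∀ a ∈ s, {b | (a, b) ∈ S}.ncard ≤ m) :
    S.ncard ≤ s.ncard * m := by
  classical
  have := Fintype.ofFinite α
  have := Fintype.ofFinite β
  rw [Set.ncard_eq_toFinset_card', Set.ncard_eq_toFinset_card', mul_comm]
  refine Finset.card_le_mul_card_image_of_maps_to (f := Prod.fst) (by simpa using hs) m ?_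
  intro a ha
  refine le_trans ?_ (hm a (by simpa using ha))
  rw [Set.ncard_eq_toFinset_card']
  refine Finset.card_le_card_of_injOn Prod.snd ?_ ?_
  · rintro ⟨x, y⟩ h
    simp only [Finset.coe_filter, Set.mem_toFinset, Set.mem_ofPred_eq] at h
    obtain ⟨h, rfl⟩ := h
    simpa using h
  · rintro ⟨x, y⟩ h ⟨x', y'⟩ h' he
    simp only [Finset.coe_filter, Set.mem_ofPred_eq] at h h' he
    rw [h.2, h'.2, he]

variable {L : Type*} [Lattice L]

theorem ncard_ltPairs_eq_sum_Iio [Fintype L] :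
    (ltPairs L).ncard = ∑ b : L, (Set.Iio b).ncard := by
  have e : ltPairs L ≃ Σ b : L, Set.Iio b :=
    { toFun q := ⟨q.1.2, q.1.1, q.2⟩
      invFun q := ⟨(q.2.1, q.1), q.2.2⟩
      left_inv _ := rfl
      right_inv _ := rfl }
  exact (Nat.card_congr e).trans Nat.card_sigma

theorem ncard_ltPairs_eq_sum_Ioi [Fintype L] :
    (ltPairs L).ncard = ∑ b : L, (Set.Ioi b).ncard := by
  have e : ltPairs L ≃ Σ b : L, Set.Ioi b :=
    { toFun q := ⟨q.1.1, q.1.2, q.2⟩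
      invFun q := ⟨(q.1, q.2.1), q.2.2⟩
      left_inv _ := rfl
      right_inv _ := rfl }
  exact (Nat.card_congr e).trans Nat.card_sigma

/-- Double counting: each strict pair is seen once from its lower and once from its upper end. -/
theorem card_mul_le_two_mul_ncard_ltPairs [Finite L] {c : ℕ}
    (h : ∀ x : L, c ≤ (Set.Iio x).ncard + (Set.Ioi x).ncard) :
    Nat.card L * c ≤ 2 * (ltPairs L).ncard := by
  have := Fintype.ofFinite L
  calc Nat.card L * c = ∑ _x : L, c := by simp
    _ ≤ ∑ x : L, ((Set.Iio x).ncard + (Set.Ioi x).ncard) := Finset.sum_le_sum fun x _ => h x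
    _ = 2 * (ltPairs L).ncard := by
      rw [Finset.sum_add_distrib, ← ncard_ltPairs_eq_sum_Iio, ← ncard_ltPairs_eq_sum_Ioi, two_mul]

theorem ncard_nonLifting_ne_top_le [Finite L] [OrderTop L] {m : ℕ}
    (hm : ∀ y : L, y ≠ ⊤ → {q ∈ ltPairs L | q.2 ≤ y}.ncard ≤ m) :
    {q ∈ nonLifting L | q.1.2 ≠ ⊤}.ncard ≤ (ltPairs L).ncard * m := by
  have hsub : {q ∈ ltPairs L | q.2 ≠ ⊤} ⊆ ltPairs L := fun q hq => hq.1
  refine (ncard_le_ncard_mul (s := {q ∈ ltPairs L | q.2 ≠ ⊤})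
    (fun x hx => ⟨hx.1.1, hx.2⟩) fun a ha => ?_).trans
    (Nat.mul_le_mul_right _ (Set.ncard_le_ncard hsub))
  have hsub' : {b | (a, b) ∈ {q ∈ nonLifting L | q.1.2 ≠ ⊤}} ⊆ {q ∈ ltPairs L | q.2 ≤ a.2} :=
    fun b hb => ⟨hb.1.2.1, hb.1.2.2.2.1⟩
  exact (Set.ncard_le_ncard hsub').trans (hm a.2 ha.2)

theorem ncard_nonLifting_le [Finite L] [OrderTop L] {m : ℕ}
    (hm : ∀ y : L, y ≠ ⊤ → {q ∈ ltPairs L | q.2 ≤ y}.ncard ≤ m) :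
    (nonLifting L).ncard ≤ (ltPairs L).ncard * m + Nat.card L * (ltPairs L).ncard := by
  have h : nonLifting L ⊆ {q ∈ nonLifting L | q.1.2 ≠ ⊤} ∪
      (fun r : L × (L × L) => ((r.1, (⊤ : L)), r.2)) '' (Set.univ ×ˢ ltPairs L) := by
    rintro ⟨⟨x, y⟩, r⟩ hq
    by_cases hy : y = ⊤
    · subst hy
      exact Or.inr ⟨(x, r), ⟨trivial, hq.2.1⟩, rfl⟩
    · exact Or.inl ⟨hq, hy⟩
  refine (Set.ncard_le_ncard h).trans ((Set.ncard_union_le _ _).trans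
    (add_le_add (ncard_nonLifting_ne_top_le hm) ((Set.ncard_image_le).trans ?_)))
  rw [Set.ncard_prod, Set.ncard_univ]

section LengthTwo

variable [Finite L] [BoundedOrder L] {A : Set L}

theorem ncard_ltPairs_of_length_two (hbt : (⊥ : L) ≠ ⊤) (hb : ⊥ ∉ A) (ht : ⊤ ∉ A)
    (hA : IsAntichain (· ≤ ·) A) (h : ∀ x : L, x = ⊥ ∨ x = ⊤ ∨ x ∈ A) :
    (ltPairs L).ncard = 2 * A.ncard + 1 := by
  have hne : ∀ x ∈ A, x ≠ ⊥ ∧ x ≠ ⊤ := fun x hx =>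
    ⟨fun h => hb (h ▸ hx), fun h => ht (h ▸ hx)⟩
  have he : ltPairs L = insert (⊥, ⊤) (({⊥} ×ˢ A) ∪ (A ×ˢ {⊤})) := by
    ext ⟨x, y⟩
    simp only [ltPairs, Set.mem_ofPred_eq, Set.mem_insert_iff, Set.mem_union, Set.mem_prod,
      Set.mem_singleton_iff, Prod.mk.injEq]
    constructor
    · intro hlt
      rcases h x with rfl | rfl | hx
      · rcases h y with rfl | rfl | hy
        · exact absurd hlt (lt_irrefl _)
        · simp
        · simp [hy]
      · exact absurd hlt not_top_lt
      · rcases h y with rfl | rfl | hy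
        · exact absurd hlt not_lt_bot
        · simp [hx]
        · exact absurd (hA.eq hx hy hlt.le) hlt.ne
    · rintro (⟨rfl, rfl⟩ | ⟨rfl, hy⟩ | ⟨hx, rfl⟩)
      · exact bot_lt_iff_ne_bot.2 hbt.symm
      · exact bot_lt_iff_ne_bot.2 (hne _ hy).1
      · exact lt_top_iff_ne_top.2 (hne _ hx).2
  rw [he, Set.ncard_insert_of_notMem (by simp [hb, ht]), Set.ncard_union_eq]
  · simp [Set.ncard_prod]; ring
  · rw [Set.disjoint_left]
    rintro ⟨x, y⟩ h1 h2
    simp only [Set.mem_prod, Set.mem_singleton_iff] at h1 h2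
    exact hb (h1.1 ▸ h2.1)

theorem card_le_of_length_two (h : ∀ x : L, x = ⊥ ∨ x = ⊤ ∨ x ∈ A) :
    Nat.card L ≤ A.ncard + 2 := by
  rw [← Set.ncard_univ]
  have : (Set.univ : Set L) ⊆ insert ⊥ (insert ⊤ A) := fun x _ => by simpa using h x
  exact (Set.ncard_le_ncard this).trans
    ((Set.ncard_insert_le _ _).trans (Nat.add_le_add_right (Set.ncard_insert_le _ _) 1))

/-- Below a proper `y` there is at most one strict pair, which gives the first term. For `y = ⊤`,
either `a = ⊥` with `x`, `b` free, or `a` is an atom, and then `x = a` and `b = ⊤`. -/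
theorem ncard_nonLifting_le_of_length_two
    (hA : IsAntichain (· ≤ ·) A) (h : ∀ x : L, x = ⊥ ∨ x = ⊤ ∨ x ∈ A) :
    (nonLifting L).ncard ≤ (ltPairs L).ncard + (Nat.card L * Nat.card L + Nat.card L) := by
  have hsub : nonLifting L ⊆ {q ∈ nonLifting L | q.1.2 ≠ ⊤} ∪
      (Set.range (fun r : L × L => ((r.1, (⊤ : L)), ((⊥ : L), r.2))) ∪
        Set.range (fun x : L => ((x, (⊤ : L)), (x, (⊤ : L))))) := by
    rintro ⟨⟨x, y⟩, ⟨a, b⟩⟩ hq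
    by_cases hy : y = ⊤
    · subst hy
      right
      obtain ⟨hx, hab, hax, -, -⟩ := hq
      simp only [ltPairs, Set.mem_ofPred_eq] at hx hab hax
      rcases h a with rfl | rfl | ha
      · exact Or.inl ⟨(x, b), rfl⟩
      · exact absurd hab not_top_lt
      right
      have hxa : x = a := by
        rcases h x with rfl | rfl | hx'
        · exact (le_bot_iff.1 hax).symm
        · exact absurd hx (lt_irrefl _)
        · exact (hA.eq ha hx' hax).symm
      have hbt : b = ⊤ := by
        rcases h b with rfl | rfl | hb
        · exact absurd hab not_lt_bot
        · rfl
        · exact absurd (hA.eq ha hb hab.le) hab.ne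
      subst hxa hbt
      exact ⟨x, rfl⟩
    · exact Or.inl ⟨hq, hy⟩
  have hm : ∀ y : L, y ≠ ⊤ → {q ∈ ltPairs L | q.2 ≤ y}.ncard ≤ 1 := by
    intro y hy
    refine (Set.ncard_le_ncard (t := {(⊥, y)}) ?_).trans (Set.ncard_singleton _).le
    rintro ⟨a, b⟩ ⟨hab, hby⟩
    simp only [ltPairs, Set.mem_ofPred_eq] at hab hby
    have hlt : ∀ {a b : L}, b ≠ ⊤ → a < b → a = ⊥ := by
      intro a b hb hab
      rcases h a with rfl | rfl | ha
      · rfl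
      · exact absurd hab not_top_lt
      rcases h b with rfl | rfl | hb'
      · exact absurd hab not_lt_bot
      · exact absurd rfl hb
      · exact absurd (hA.eq ha hb' hab.le) hab.ne
    have hb : b ≠ ⊤ := fun h => hy (top_le_iff.1 (h ▸ hby))
    obtain rfl : a = ⊥ := hlt hb hab
    rcases hby.eq_or_lt with rfl | hby
    · rfl
    · exact absurd (hlt hy hby ▸ hab) (lt_irrefl _)
  refine (Set.ncard_le_ncard hsub).trans ((Set.ncard_union_le _ _).trans (add_le_add
    ((ncard_nonLifting_ne_top_le hm).trans (mul_one _).le)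
    ((Set.ncard_union_le _ _).trans (add_le_add ?_ ?_))))
  · rw [← Set.image_univ, ← Nat.card_prod, ← Set.ncard_univ]
    exact Set.ncard_image_le
  · rw [← Set.image_univ, ← Set.ncard_univ]
    exact Set.ncard_image_le

/-- For distinct `x`, `b` in the antichain, `x → ⊤` fails to lift against `⊥ → b`. -/
theorem le_ncard_nonLifting_of_length_two (hb : ⊥ ∉ A) (ht : ⊤ ∉ A)
    (hA : IsAntichain (· ≤ ·) A) :
    A.ncard * (A.ncard - 1) ≤ (nonLifting L).ncard := by
  classical
  have := Fintype.ofFinite L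
  have h1 : (fun r : L × L => ((r.1, (⊤ : L)), ((⊥ : L), r.2))) '' (A.toFinset.offDiag : Set _) ⊆
      nonLifting L := by
    rintro _ ⟨⟨x, b⟩, hr, rfl⟩
    simp only [Finset.coe_offDiag, Set.coe_toFinset, Set.mem_offDiag] at hr
    obtain ⟨hx, hb', hne⟩ := hr
    refine ⟨lt_top_iff_ne_top.2 fun h => ht (h ▸ hx), bot_lt_iff_ne_bot.2 fun h => hb (h ▸ hb'),
      bot_le, le_top, fun h => hne (hA.eq hb' hx h).symm⟩
  have h2 := Set.ncard_le_ncard h1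
  rw [Set.ncard_image_of_injective _ (fun r s h => by simpa [Prod.ext_iff] using h),
    Set.ncard_coe_finset, Finset.offDiag_card, ← Set.ncard_eq_toFinset_card'] at h2
  rwa [Nat.mul_sub, mul_one]

end LengthTwo

end Lattice

/-! ### Subspace lattices over a finite field -/

section VectorSpace

variable {k V : Type*} [Field k] [Finite k] [AddCommGroup V] [Module k V] [Finite V]

open Module Projectivization
open scoped LinearAlgebra.Projectivization

/-- Counts only the lines and the zero subspace. -/
theorem pow_lt_card_submodule (h : 1 ≤ finrank k V) :
    Nat.card k ^ (finrank k V - 1) + 1 ≤ Nat.card (Submodule k V) := by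
  have h1 : 1 < Nat.card k := Finite.one_lt_card
  have h2 := Projectivization.card' k V
  rw [Module.natCard_eq_pow_finrank (K := k)] at h2
  obtain ⟨d, hd⟩ : ∃ d, finrank k V = d + 1 := ⟨_, (Nat.sub_add_cancel h).symm⟩
  have h3 : Nat.card k ^ d ≤ Nat.card (ℙ k V) := by
    obtain ⟨r, hr⟩ : ∃ r, Nat.card k = r + 2 := ⟨_, (Nat.sub_add_cancel h1).symm⟩
    rw [hd, hr, pow_succ] at h2
    rw [hr]
    have : 0 < (r + 2) ^ d := by positivity
    have h4 : (r + 2 - 1) = r + 1 := by omega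
    rw [h4] at h2
    refine Nat.le_of_mul_le_mul_right (c := r + 1) ?_ (by omega)
    nlinarith
  have h4 : Nat.card (Option (ℙ k V)) ≤ Nat.card (Submodule k V) := by
    refine Nat.card_le_card_of_injective
      (fun o => o.elim ⊥ Projectivization.submodule) ?_
    have hne : ∀ p : ℙ k V, p.submodule ≠ ⊥ := fun p hp => by
      have := p.finrank_submodule
      rw [hp, finrank_bot] at this
      exact zero_ne_one this
    rintro (_ | p) (_ | p') hpp
    · rfl
    · exact absurd hpp.symm (hne p')
    · exact absurd hpp (hne p)
    · exact congrArg some (Projectivization.submodule_injective hpp)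
  rw [Finite.card_option] at h4
  rw [hd]
  exact (Nat.add_le_add_right h3 1).trans h4

theorem pow_le_ncard_Iio (x : Submodule k V) (h : 1 ≤ finrank k x) :
    Nat.card k ^ (finrank k x - 1) ≤ (Set.Iio x).ncard := by
  have h1 := pow_lt_card_submodule h
  rw [Nat.card_congr x.mapIic.toEquiv, Nat.card_coe_set_eq, ← Set.Iio_insert,
    Set.ncard_insert_of_notMem (by simp)] at h1
  omega

theorem pow_le_ncard_Ioi (x : Submodule k V) (h : finrank k x + 1 ≤ finrank k V) :
    Nat.card k ^ (finrank k V - finrank k x - 1) ≤ (Set.Ioi x).ncard := by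
  have h0 : finrank k (V ⧸ x) = finrank k V - finrank k x := by
    have := x.finrank_quotient_add_finrank
    omega
  have : Finite (V ⧸ x) := Module.finite_of_finite k
  have h1 := pow_lt_card_submodule (k := k) (V := V ⧸ x) (by omega)
  rw [Nat.card_congr (Submodule.comapMkQRelIso x).toEquiv, Nat.card_coe_set_eq,
    ← Set.Ioi_insert, Set.ncard_insert_of_notMem (by simp), h0] at h1
  omega

theorem card_submodule_mul_pow_le (h : 1 ≤ finrank k V) :
    Nat.card (Submodule k V) * Nat.card k ^ ((finrank k V - 1) / 2) ≤
      2 * (ltPairs (Submodule k V)).ncard := by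
  refine card_mul_le_two_mul_ncard_ltPairs fun x => ?_
  have hk : 0 < Nat.card k := Nat.card_pos
  have hx := x.finrank_le
  -- A subspace of large dimension has many subspaces below it, one of small dimension many above.
  rcases le_or_gt ((finrank k V - 1) / 2 + 1) (finrank k x) with h1 | h1
  · exact (Nat.pow_le_pow_right hk (by omega)).trans
      ((pow_le_ncard_Iio x (by omega)).trans (Nat.le_add_right _ _))
  · exact (Nat.pow_le_pow_right hk (by omega)).trans
      ((pow_le_ncard_Ioi x (by omega)).trans (Nat.le_add_left _ _))

-- Tilt a pair inside the hyperplane `ker f` along `v` by the graph map `u ↦ u + φ u • v`. The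
-- projection `π` along `v` recovers the original pair, and `f` recovers `φ`.
omit [Finite k] in
theorem card_sigma_dual_le {f : V →ₗ[k] k} {v : V} (hv : f v = 1) :
    Nat.card (Σ q : {q ∈ ltPairs (Submodule k V) | q.2 ≤ LinearMap.ker f}, Dual k q.1.2) ≤
      (ltPairs (Submodule k V)).ncard := by
  let τ : ∀ b : Submodule k V, Dual k b → b →ₗ[k] V := fun b φ =>
    b.subtype + φ.smulRight v
  let π : V →ₗ[k] V := LinearMap.id - f.smulRight v
  have hf : ∀ (b : Submodule k V) (φ : Dual k b), b ≤ LinearMap.ker f →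
      ∀ u, f (τ b φ u) = φ u := by
    intro b φ hb u
    have : f u = 0 := hb u.2
    simp [τ, this, hv]
  have hπ : ∀ (b : Submodule k V) (φ : Dual k b), b ≤ LinearMap.ker f →
      π ∘ₗ τ b φ = b.subtype := by
    intro b φ hb
    ext u
    have : f u = 0 := hb u.2
    simp [π, τ, this, hv]
  have hinj : ∀ (b : Submodule k V) (φ : Dual k b), b ≤ LinearMap.ker f →
      Function.Injective (τ b φ) := by
    intro b φ hb
    have : Function.Injective (π ∘ₗ τ b φ) := by rw [hπ b φ hb]; exact b.injective_subtype
    exact Function.Injective.of_comp (f := π) this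
  refine Nat.card_le_card_of_injective (β := ltPairs (Submodule k V))
    (fun r => ⟨((r.1.1.1.comap r.1.1.2.subtype).map (τ _ r.2), (⊤ : Submodule k _).map (τ _ r.2)),
      ?_⟩) ?_
  · obtain ⟨⟨⟨a, b⟩, hab, hb⟩, φ⟩ := r
    refine Submodule.map_strictMono_of_injective (hinj b φ hb) (lt_top_iff_ne_top.2 fun h => ?_)
    exact (not_le_of_gt hab) (Submodule.comap_subtype_eq_top.1 h)
  · rintro ⟨⟨⟨a, b⟩, hab, hb⟩, φ⟩ ⟨⟨⟨a', b'⟩, hab', hb'⟩, φ'⟩ h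
    simp only [Subtype.mk.injEq, Prod.mk.injEq] at h
    obtain ⟨h1, h2⟩ := h
    have h1' := congrArg (Submodule.map π) h1
    have h2' := congrArg (Submodule.map π) h2
    rw [← Submodule.map_comp, ← Submodule.map_comp, hπ _ _ hb, hπ _ _ hb'] at h1' h2'
    simp only [Submodule.map_comap_subtype, Submodule.map_top, Submodule.range_subtype] at h1' h2'
    subst h2'
    rw [inf_eq_right.2 (le_of_lt hab), inf_eq_right.2 (le_of_lt hab')] at h1'
    subst h1'
    have : φ = φ' := by
      ext u
      have hu : τ b φ u ∈ (⊤ : Submodule k b).map (τ b φ') := h2 ▸ ⟨u, trivial, rfl⟩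
      obtain ⟨u', -, hu'⟩ := hu
      have h3 : u' = u := by
        have := congrArg π hu'
        rw [← LinearMap.comp_apply, ← LinearMap.comp_apply, hπ _ _ hb, hπ _ _ hb] at this
        exact Subtype.ext this
      subst h3
      rw [← hf b φ hb, ← hu', hf b φ' hb]
    rw [this]

-- Enlarge the top of the pair by the line through `v + h`, with `h` a representative of a class
-- modulo `b`. Intersecting with `ker f` recovers `b`, and the enlarged space determines `h` modulo
-- `b`.
omit [Finite k] in
theorem card_sigma_quotient_le {f : V →ₗ[k] k} {v : V} (hv : f v = 1) :
    Nat.card (Σ q : {q ∈ ltPairs (Submodule k V) | q.2 ≤ LinearMap.ker f},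
      LinearMap.ker f ⧸ q.1.2.comap (LinearMap.ker f).subtype) ≤
      (ltPairs (Submodule k V)).ncard := by
  have hfw : ∀ h : LinearMap.ker f, f (v + h) = 1 := fun h => by
    have : f h = 0 := h.2
    rw [map_add, hv, this, add_zero]
  have hinf : ∀ (b : Submodule k V) (h : LinearMap.ker f), b ≤ LinearMap.ker f →
      (b ⊔ Submodule.span k {v + (h : V)}) ⊓ LinearMap.ker f = b := by
    intro b h hb
    refine le_antisymm ?_ (le_inf le_sup_left hb)
    rintro u ⟨hu, huf⟩
    obtain ⟨y, hy, z, hz, rfl⟩ := Submodule.mem_sup.1 hu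
    obtain ⟨c, rfl⟩ := Submodule.mem_span_singleton.1 hz
    have h1 : f y = 0 := hb hy
    have h2 : f (y + c • (v + (h : V))) = 0 := huf
    rw [map_add, map_smul, h1, hfw, zero_add, smul_eq_mul, mul_one] at h2
    simpa [h2] using hy
  refine Nat.card_le_card_of_injective (β := ltPairs (Submodule k V))
    (fun r => ⟨(r.1.1.1, r.1.1.2 ⊔ Submodule.span k {v + (r.2.out : V)}),
      lt_of_lt_of_le (show r.1.1.1 < r.1.1.2 from r.1.2.1) le_sup_left⟩) ?_
  rintro ⟨⟨⟨a, b⟩, hab, hb⟩, h⟩ ⟨⟨⟨a', b'⟩, hab', hb'⟩, h'⟩ he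
  obtain ⟨h1, he⟩ := Prod.ext_iff.1 (Subtype.ext_iff.1 he)
  dsimp only at h1 he
  subst h1
  have hbb := congrArg (· ⊓ LinearMap.ker f) he
  rw [hinf b _ hb, hinf b' _ hb'] at hbb
  subst hbb
  have : h = h' := by
    rw [← Quotient.out_eq h, ← Quotient.out_eq h']
    refine (Submodule.Quotient.eq _).2 ?_
    have hmem : v + (h.out : V) ∈ b ⊔ Submodule.span k {v + (h'.out : V)} :=
      he ▸ Submodule.mem_sup_right (Submodule.mem_span_singleton_self _)
    obtain ⟨y, hy, z, hz, hyz⟩ := Submodule.mem_sup.1 hmem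
    obtain ⟨c, rfl⟩ := Submodule.mem_span_singleton.1 hz
    have h1 : f y = 0 := hb hy
    have h2 := congrArg f hyz
    rw [map_add, map_smul, h1, hfw, hfw, zero_add, smul_eq_mul, mul_one] at h2
    subst h2
    have : ((h.out - h'.out : LinearMap.ker f) : V) = y := by
      rw [one_smul] at hyz
      rw [Submodule.coe_sub, sub_eq_iff_eq_add]
      have : v + (h.out : V) = v + (y + h'.out) := by rw [← hyz]; abel
      exact add_left_cancel this
    change ((h.out - h'.out : LinearMap.ker f) : V) ∈ b
    rwa [this]
  rw [this]

theorem ncard_ltPairs_le_mul_pow_le {y : Submodule k V} (hy : y ≠ ⊤) :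
    {q ∈ ltPairs (Submodule k V) | q.2 ≤ y}.ncard * Nat.card k ^ (finrank k V / 2) ≤
      2 * (ltPairs (Submodule k V)).ncard := by
  obtain ⟨f, hf, hyf⟩ := Submodule.exists_le_ker_of_lt_top y (lt_top_iff_ne_top.2 hy)
  obtain ⟨v, hv⟩ := LinearMap.surjective hf 1
  have hfin : finrank k (LinearMap.ker f) + 1 = finrank k V :=
    Module.Dual.finrank_ker_add_one_of_ne_zero hf
  refine (Nat.mul_le_mul_right _ (Set.ncard_le_ncard
    (t := {q ∈ ltPairs (Submodule k V) | q.2 ≤ LinearMap.ker f})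
    fun q hq => ⟨hq.1, hq.2.trans hyf⟩)).trans ?_
  have := Fintype.ofFinite {q ∈ ltPairs (Submodule k V) | q.2 ≤ LinearMap.ker f}
  have h1 := card_sigma_dual_le hv
  have h2 := card_sigma_quotient_le hv
  have (b : Submodule k V) : Finite (Dual k b) := Module.finite_of_finite k
  have (b : Submodule k (LinearMap.ker f)) : Finite (LinearMap.ker f ⧸ b) :=
    Module.finite_of_finite k
  rw [Nat.card_sigma] at h1 h2
  rw [two_mul]
  refine le_trans ?_ (add_le_add h1 h2)
  rw [← Finset.sum_add_distrib, ← Nat.card_coe_set_eq, Nat.card_eq_fintype_card,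
    ← smul_eq_mul, ← Finset.card_univ, ← Finset.sum_const]
  refine Finset.sum_le_sum fun q _ => ?_
  have hk : 0 < Nat.card k := Nat.card_pos
  have hb := (Submodule.comapSubtypeEquivOfLe q.2.2).finrank_eq
  have hq := (q.1.2.comap (LinearMap.ker f).subtype).finrank_quotient_add_finrank
  rw [Module.natCard_eq_pow_finrank (K := k) (V := Dual k q.1.2),
    Module.natCard_eq_pow_finrank (K := k) (V := _ ⧸ _), Subspace.dual_finrank_eq]
  -- With d = dim b and n = dim V, the two constructions produce q^d and q^(n-1-d) pairs from `(a,
  -- b)`; one of the exponents is at least ⌊n/2⌋.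
  rcases le_or_gt (finrank k V / 2) (finrank k q.1.2) with h | h
  · exact (Nat.pow_le_pow_right hk h).trans (Nat.le_add_right _ _)
  · exact (Nat.pow_le_pow_right hk (by omega)).trans (Nat.le_add_left _ _)

end VectorSpace

section VectorSpace

variable {k V : Type*} [Field k] [Finite k] [AddCommGroup V] [Module k V] [Finite V]

open Module

theorem ncard_nonLifting_mul_pow_le (h : 1 ≤ finrank k V) :
    (nonLifting (Submodule k V)).ncard * Nat.card k ^ ((finrank k V - 1) / 2) ≤
      4 * (ltPairs (Submodule k V)).ncard ^ 2 := by
  have hk : 0 < Nat.card k := Nat.card_pos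
  set N := (ltPairs (Submodule k V)).ncard
  have hQ : (nonLifting (Submodule k V)).ncard ≤ N * (2 * N / Nat.card k ^ (finrank k V / 2)) +
      Nat.card (Submodule k V) * N := ncard_nonLifting_le fun y hy => by
    rw [Nat.le_div_iff_mul_le (by positivity)]
    exact ncard_ltPairs_le_mul_pow_le hy
  have hm : 2 * N / Nat.card k ^ (finrank k V / 2) * Nat.card k ^ ((finrank k V - 1) / 2) ≤
      2 * N :=
    (Nat.mul_le_mul_left _ (Nat.pow_le_pow_right hk (by omega))).trans (Nat.div_mul_le_self _ _)
  have hK := card_submodule_mul_pow_le h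
  calc _ ≤ _ := Nat.mul_le_mul_right _ hQ
    _ = N * (2 * N / Nat.card k ^ (finrank k V / 2) * Nat.card k ^ ((finrank k V - 1) / 2)) +
      Nat.card (Submodule k V) * Nat.card k ^ ((finrank k V - 1) / 2) * N := by ring
    _ ≤ N * (2 * N) + 2 * N * N :=
      add_le_add (Nat.mul_le_mul_left _ hm) (Nat.mul_le_mul_right _ hK)
    _ = 4 * N ^ 2 := by ring

omit [Finite k] in
theorem submodule_trichotomy (h : finrank k V = 2) (x : Submodule k V) :
    x = ⊥ ∨ x = ⊤ ∨ x ∈ {H : Submodule k V | finrank k H = 1} := by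
  have hx := x.finrank_le
  rw [h] at hx
  interval_cases hd : finrank k x
  · exact Or.inl (Submodule.finrank_eq_zero.1 hd)
  · exact Or.inr (Or.inr hd)
  · exact Or.inr (Or.inl (Submodule.eq_top_of_finrank_eq (hd.trans h.symm)))

omit [Finite k] in
theorem isAntichain_lines : IsAntichain (· ≤ ·) {H : Submodule k V | finrank k H = 1} := by
  intro x hx y hy hne hle
  exact hne (Submodule.eq_of_le_of_finrank_eq hle (Eq.trans hx (Eq.symm hy)))

omit [Finite V] in
theorem ncard_lines (h : finrank k V = 2) :
    {H : Submodule k V | finrank k H = 1}.ncard = Nat.card k + 1 := by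
  rw [← Projectivization.card_of_finrank_two k V h]
  exact (Nat.card_congr (Projectivization.equivSubmodule k V)).symm

end VectorSpace

theorem ncard_bounds_of_finrank_two {k V : Type*} [Field k] [Finite k] [AddCommGroup V] [Module k V]
    [Finite V] (h : Module.finrank k V = 2) :
    (ltPairs (Submodule k V)).ncard = 2 * (Nat.card k + 1) + 1 ∧
    (Nat.card k + 1) * Nat.card k ≤ (nonLifting (Submodule k V)).ncard ∧
    (nonLifting (Submodule k V)).ncard ≤ (Nat.card k + 1) ^ 2 + 7 * (Nat.card k + 1) + 7 := by
  have hb : (⊥ : Submodule k V) ∉ {H : Submodule k V | Module.finrank k H = 1} := by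
    simp
  have ht : (⊤ : Submodule k V) ∉ {H : Submodule k V | Module.finrank k H = 1} := by
    simp [h]
  have hbt : (⊥ : Submodule k V) ≠ ⊤ := by
    intro he
    have := congrArg (fun H : Submodule k V => Module.finrank k H) he
    simp [h] at this
  have hN := ncard_ltPairs_of_length_two hbt hb ht isAntichain_lines (submodule_trichotomy h)
  have hK := card_le_of_length_two (submodule_trichotomy h)
  have hQ := ncard_nonLifting_le_of_length_two isAntichain_lines (submodule_trichotomy h)
  have hQ' := le_ncard_nonLifting_of_length_two hb ht isAntichain_lines
  rw [ncard_lines h] at hN hK hQ'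
  refine ⟨hN, by simpa using hQ', ?_⟩
  rw [hN] at hQ
  have := Nat.mul_le_mul hK hK
  -- With A = q + 1 lines and at most A + 2 subspaces, (2A + 1) + (A + 2)² + (A + 2) = A² + 7A + 7.
  nlinarith

/-! ### Elementary abelian groups and the limits -/

/-- Subgroups of `C_p^n` are subspaces of `𝔽_p^n`. -/
def subgroupElemAbEquiv (p n : ℕ) :
    Subgroup (ElemAb p n) ≃o Submodule (ZMod p) (Fin n → ZMod p) :=
  let e : Additive (ElemAb p n) ≃+ (Fin n → ZMod p) :=
    { toFun f i := (f.toMul i).toAdd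
      invFun f := Additive.ofMul fun i => Multiplicative.ofAdd (f i)
      left_inv _ := rfl
      right_inv _ := rfl
      map_add' _ _ := rfl }
  (Subgroup.toAddSubgroup.trans e.mapAddSubgroup).trans (AddSubgroup.toZModSubmodule p)

open scoped Pointwise in
theorem conjAct_smul_eq_self {G : Type*} [Group G] (hG : ∀ x y : G, x * y = y * x)
    (g : ConjAct G) (H : Subgroup G) : g • H = H := by
  have h (x : G) : g⁻¹ • x = x := by rw [ConjAct.smul_def, hG, inv_mul_cancel_left]
  ext x
  rw [Subgroup.mem_pointwise_smul_iff_inv_smul_mem, h]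

open scoped Pointwise in
theorem codensity_elemAb (p n : ℕ) [Fact p.Prime] :
    codensity (TrSub (ElemAb p n)) =
      ((nonLifting (Submodule (ZMod p) (Fin n → ZMod p))).ncard : ℝ) /
        ((ltPairs (Submodule (ZMod p) (Fin n → ZMod p))).ncard : ℝ) ^ 2 := by
  rw [codensity_transferSystem (G := ConjAct (ElemAb p n)) (L := Subgroup (ElemAb p n))
      (conjAct_smul_eq_self mul_comm),
    ncard_nonLifting_congr (subgroupElemAbEquiv p n), ncard_ltPairs_congr (subgroupElemAbEquiv p n)]

theorem codensity_nonneg (L : Type*) [Lattice L] [Finite L] : 0 ≤ codensity L := by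
  unfold codensity; positivity

theorem codensity_elemAb_le (p n : ℕ) [hp : Fact p.Prime] (hn : 1 ≤ n) :
    codensity (TrSub (ElemAb p n)) ≤ 4 / (p : ℝ) ^ ((n - 1) / 2) := by
  have h := ncard_nonLifting_mul_pow_le (k := ZMod p) (V := Fin n → ZMod p) (by simpa using hn)
  rw [Module.finrank_fin_fun, Nat.card_zmod] at h
  have hp0 : (0 : ℝ) < p := Nat.cast_pos.2 hp.out.pos
  rw [codensity_elemAb, le_div_iff₀ (by positivity), div_mul_eq_mul_div]
  refine div_le_of_le_mul₀ (by positivity) (by norm_num) ?_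
  exact_mod_cast h

theorem codensity_elemAb_two_bounds (p : ℕ) [hp : Fact p.Prime] :
    ((p : ℝ) + 1) * p / (2 * (p + 1) + 1) ^ 2 ≤ codensity (TrSub (ElemAb p 2)) ∧
      codensity (TrSub (ElemAb p 2)) ≤
        (((p : ℝ) + 1) ^ 2 + 7 * (p + 1) + 7) / (2 * (p + 1) + 1) ^ 2 := by
  obtain ⟨h1, h2, h3⟩ := ncard_bounds_of_finrank_two (k := ZMod p) (V := Fin 2 → ZMod p) (by simp)
  rw [Nat.card_zmod] at h1 h2 h3
  rw [codensity_elemAb, h1]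
  push_cast
  constructor
  · gcongr
    exact_mod_cast h2
  · gcongr
    exact_mod_cast h3

theorem tendsto_quadratic_div (a b : ℝ) :
    Tendsto (fun x : ℝ => (x ^ 2 + a * x + b) / (2 * x + 1) ^ 2) atTop (𝓝 (1 / 4)) := by
  have h1 : Tendsto (fun x : ℝ => (1 + a * x⁻¹ + b * (x⁻¹ * x⁻¹)) / (2 + x⁻¹) ^ 2) atTop
      (𝓝 ((1 + a * 0 + b * (0 * 0)) / (2 + 0) ^ 2)) := by
    have h0 := tendsto_inv_atTop_zero (𝕜 := ℝ)
    exact ((tendsto_const_nhds.add (h0.const_mul a)).add ((h0.mul h0).const_mul b)).div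
      ((tendsto_const_nhds.add h0).pow 2) (by norm_num)
  have h2 : (1 + a * 0 + b * (0 * 0)) / (2 + 0) ^ 2 = (1 / 4 : ℝ) := by norm_num
  rw [h2] at h1
  refine h1.congr' ?_
  filter_upwards [eventually_gt_atTop 0] with x hx
  have : 2 + x⁻¹ ≠ 0 := by positivity
  have : 2 * x + 1 ≠ 0 := by positivity
  field_simp

theorem tendsto_codensity_elemAb_two :
    Tendsto (fun p : Nat.Primes => codensity (TrSub (ElemAb (p : ℕ) 2)))
      (comap (fun p : Nat.Primes => (p : ℕ)) atTop) (𝓝 (1 / 4)) := by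
  have hx : Tendsto (fun p : Nat.Primes => ((p : ℕ) : ℝ) + 1)
      (comap (fun p : Nat.Primes => (p : ℕ)) atTop) atTop :=
    tendsto_atTop_add_const_right _ _ (tendsto_natCast_atTop_atTop.comp tendsto_comap)
  -- In the variable x = p + 1 the lower numerator (p + 1)p is x² - x.
  refine tendsto_of_tendsto_of_tendsto_of_le_of_le ((tendsto_quadratic_div (-1) 0).comp hx)
    ((tendsto_quadratic_div 7 7).comp hx) (fun p => ?_) fun p =>
      (codensity_elemAb_two_bounds (p : ℕ)).2
  refine (le_of_eq ?_).trans (codensity_elemAb_two_bounds (p : ℕ)).1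
  simp only [Function.comp_apply]
  ring

theorem tendsto_codensity_elemAb_of_two_lt {n : ℕ} (hn : 2 < n) :
    Tendsto (fun p : Nat.Primes => codensity (TrSub (ElemAb (p : ℕ) n)))
      (comap (fun p : Nat.Primes => (p : ℕ)) atTop) (𝓝 0) := by
  have hx : Tendsto (fun p : Nat.Primes => 4 / ((p : ℕ) : ℝ) ^ ((n - 1) / 2))
      (comap (fun p : Nat.Primes => (p : ℕ)) atTop) (𝓝 0) :=
    -- The exponent ⌊(n-1)/2⌋ is nonzero precisely because n > 2.
    tendsto_const_nhds.div_atTop ((tendsto_pow_atTop (by omega)).comp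
      (tendsto_natCast_atTop_atTop.comp tendsto_comap))
  exact squeeze_zero (fun _ => codensity_nonneg _)
    (fun p => codensity_elemAb_le (p : ℕ) n (by omega)) hx

theorem tendsto_codensity_elemAb_atTop (p : ℕ) [hp : Fact p.Prime] :
    Tendsto (fun n : ℕ => codensity (TrSub (ElemAb p n))) atTop (𝓝 0) := by
  have he : Tendsto (fun n : ℕ => (n - 1) / 2) atTop atTop :=
    (Nat.tendsto_div_const_atTop two_ne_zero).comp (tendsto_sub_atTop_nat 1)
  have hx : Tendsto (fun n : ℕ => 4 / (p : ℝ) ^ ((n - 1) / 2)) atTop (𝓝 0) :=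
    tendsto_const_nhds.div_atTop
      ((tendsto_pow_atTop_atTop_of_one_lt (Nat.one_lt_cast.2 hp.out.one_lt)).comp he)
  refine squeeze_zero' (Eventually.of_forall fun _ => codensity_nonneg _) ?_ hx
  filter_upwards [eventually_ge_atTop 1] with n hn using codensity_elemAb_le p n hn

end HomotopicalCombinatorics

theorem corollary6p2 :
    (∀ n : ℕ, 2 ≤ n →
      Tendsto
        (fun p : Nat.Primes =>
          HomotopicalCombinatorics.codensity
            (HomotopicalCombinatorics.TrSub (HomotopicalCombinatorics.ElemAb (p : ℕ) n)))
        (Filter.comap (fun p : Nat.Primes => (p : ℕ)) atTop)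
        (𝓝 (if n = 2 then (1 / 4 : ℝ) else 0))) ∧
    (∀ p : Nat.Primes,
      Tendsto
        (fun n : ℕ =>
          HomotopicalCombinatorics.codensity
            (HomotopicalCombinatorics.TrSub (HomotopicalCombinatorics.ElemAb (p : ℕ) n)))
        atTop (𝓝 0)) := by
  refine ⟨fun n hn => ?_, fun p => HomotopicalCombinatorics.tendsto_codensity_elemAb_atTop p⟩
  split_ifs with h
  · subst h
    exact HomotopicalCombinatorics.tendsto_codensity_elemAb_two
  · exact HomotopicalCombinatorics.tendsto_codensity_elemAb_of_two_lt (by omega)
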